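/- Let $H$ be a positive definite Hermitian $n\times n$ matrix, let $\rho_H(z)=\overline z^{T}Hz$ for $z\in\mathbb{C}^n$, and let $D=D_H=\{z\in\mathbb{C}^n:\rho_H(z)<1\}$. Let $\operatorname{PSH}(D)^-$ be the family of non-positive plurisubharmonic functions $u:D\to[-\infty,0]$. For $\zeta\in\partial D$ put $$u^*(\zeta)=\limsup_{z\to\zeta,\ z\in D}u(z),\qquad u^n(\zeta)=\limsup_{t\downarrow 0}u\bigl(n(\zeta,t)\bigr),\qquad u^R(\zeta)=\limsup_{r\uparrow 1}u(r\zeta),$$ where $n(\zeta,t)=\zeta-t\left(\frac{\partial\rho}{\partial\overline z_1}(\zeta),\dots,\frac{\partial\rho}{\partial\overline z_n}(\zeta)\right)$ with $\rho=\rho_H-1$; for $t>0$ this parametrizes the inward normal to $\partial D$ at $\zeta$. For a compact set $A\subset\partial D$ and $z\in D$ define the boundary relative extremal functions \begin{align*} \omega^c(z,A,D)&=\sup\{u(z): u\in\operatorname{PSH}(D)^-\cap C(\overline D),\ u\le-1\text{ on }A\},\\ \omega(z,A,D)&=\sup\{u(z): u\in\operatorname{PSH}(D)^-,\ u^*\le-1\text{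 on }A\},\\ \omega^n(z,A,D)&=\sup\{u(z): u\in\operatorname{PSH}(D)^-,\ u^n\le-1\text{ on }A\},\\ \omega^R(z,A,D)&=\sup\{u(z): u\in\operatorname{PSH}(D)^-,\ u^R\le-1\text{ on }A\}. \end{align*} Then for every compact $A\subset\partial D_H$ and every $z\in D_H$, $$\omega(z,A,D_H)=\omega^n(z,A,D_H)=\omega^R(z,A,D_H)=\omega^c(z,A,D_H).$$ -/

import Mathlib

open Filter Topology MeasureTheory
open scoped ComplexOrder

namespace BoundaryExtremal

noncomputable section

/-- The integral `∫ f⁺ - ∫ f⁻` over `[0,1]` of an extended real valued function. It is used only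
for functions that are bounded above, so that the first term is finite; its value may be `-∞`. -/
def unitIntegral (f : ℝ → EReal) : EReal :=
  ((∫⁻ t in Set.Icc (0 : ℝ) 1, (f t).toENNReal : ENNReal) : EReal) -
    ((∫⁻ t in Set.Icc (0 : ℝ) 1, (-f t).toENNReal : ENNReal) : EReal)

/-- `u` (of which only the values on the open set `D` matter) is plurisubharmonic on `D`: it takes
values in `ℝ ∪ {-∞}`, it is upper semicontinuous on `D`, and it satisfies the sub-mean value
inequality on every closed disc `{a + ζ b : |ζ| ≤ 1}` contained in `D`. The constant `-∞` is
allowed. -/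
structure IsPSH {n : ℕ} (D : Set (Fin n → ℂ)) (u : (Fin n → ℂ) → EReal) : Prop where
  lt_top : ∀ z ∈ D, u z < ⊤
  usc : UpperSemicontinuousOn u D
  sub_mean : ∀ a b : Fin n → ℂ, (∀ ζ : ℂ, ‖ζ‖ ≤ 1 → a + ζ • b ∈ D) →
    u a ≤ unitIntegral fun t => u (a + Complex.exp (2 * Real.pi * t * Complex.I) • b)

/-- The class of non-positive plurisubharmonic functions on `D`. -/
def PSHNeg {n : ℕ} (D : Set (Fin n → ℂ)) : Set ((Fin n → ℂ) → EReal) :=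
  {u | IsPSH D u ∧ ∀ z ∈ D, u z ≤ 0}

/-- The boundary value `u^*(ζ)`: the upper limit of `u` at `ζ` from within `D`. -/
def upperLimit {n : ℕ} (D : Set (Fin n → ℂ)) (u : (Fin n → ℂ) → EReal) (ζ : Fin n → ℂ) : EReal :=
  limsup u (𝓝[D] ζ)

/-- The vector `(∂ρ/∂z̄₁, …, ∂ρ/∂z̄ₙ)` at `z`, with `∂/∂z̄ⱼ = (∂/∂xⱼ + i ∂/∂yⱼ) / 2`. -/
def dbarGrad {n : ℕ} (ρ : (Fin n → ℂ) → ℝ) (z : Fin n → ℂ) : Fin n → ℂ := fun j =>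
  (1 / 2 : ℂ) * ((fderiv ℝ ρ z (Pi.single j 1) : ℂ) +
    Complex.I * (fderiv ℝ ρ z (Pi.single j Complex.I) : ℂ))

/-- The parametrization `n(z,t) = z - t ∂ρ/∂z̄(z)` of the normal line at `z`; at a boundary point of
`{ρ < 0}` the inward normal corresponds to `t > 0`. -/
def normalPoint {n : ℕ} (ρ : (Fin n → ℂ) → ℝ) (z : Fin n → ℂ) (t : ℝ) : Fin n → ℂ :=
  z - (t : ℂ) • dbarGrad ρ z

/-- The boundary value of `u` at `ζ` along the inward normal. -/
def normalLimit {n : ℕ} (ρ : (Fin n → ℂ) → ℝ) (u : (Fin n → ℂ) → EReal) (ζ : Fin n → ℂ) : EReal :=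
  limsup (fun t : ℝ => u (normalPoint ρ ζ t)) (𝓝[>] 0)

/-- The radial boundary value of `u` at `ζ`. -/
def radialLimit {n : ℕ} (u : (Fin n → ℂ) → EReal) (ζ : Fin n → ℂ) : EReal :=
  limsup (fun r : ℝ => u ((r : ℂ) • ζ)) (𝓝[<] 1)

/-- `ω^c(z, A, D)`: the supremum over the functions that are non-positive and plurisubharmonic on
`D`, real valued and continuous on `closure D`, and at most `-1` on `A`. -/
def omegaC {n : ℕ} (D A : Set (Fin n → ℂ)) (z : Fin n → ℂ) : EReal :=
  sSup {x : EReal | ∃ u : (Fin n → ℂ) → ℝ, (fun w => (u w : EReal)) ∈ PSHNeg D ∧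
    ContinuousOn u (closure D) ∧ (∀ ζ ∈ A, u ζ ≤ -1) ∧ x = (u z : EReal)}

/-- `ω(z, A, D)`: the boundary condition is `u^* ≤ -1` on `A`. -/
def omega {n : ℕ} (D A : Set (Fin n → ℂ)) (z : Fin n → ℂ) : EReal :=
  sSup {x : EReal | ∃ u ∈ PSHNeg D, (∀ ζ ∈ A, upperLimit D u ζ ≤ -1) ∧ x = u z}

/-- `ω^n(z, A, D)`, where `ρ` is a defining function of `D`: the boundary condition is on the upper
limits along the inward normals at the points of `A`. -/
def omegaN {n : ℕ} (D : Set (Fin n → ℂ)) (ρ : (Fin n → ℂ) → ℝ) (A : Set (Fin n → ℂ))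
    (z : Fin n → ℂ) : EReal :=
  sSup {x : EReal | ∃ u ∈ PSHNeg D, (∀ ζ ∈ A, normalLimit ρ u ζ ≤ -1) ∧ x = u z}

/-- `ω^R(z, A, D)`, for `D` strongly star shaped with respect to `0`: the boundary condition is on
the radial upper limits at the points of `A`. -/
def omegaR {n : ℕ} (D A : Set (Fin n → ℂ)) (z : Fin n → ℂ) : EReal :=
  sSup {x : EReal | ∃ u ∈ PSHNeg D, (∀ ζ ∈ A, radialLimit u ζ ≤ -1) ∧ x = u z}

/-- `ρ_H(z) = z̄ᵀ H z` (a real number for Hermitian `H`). -/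
def hermForm {n : ℕ} (H : Matrix (Fin n) (Fin n) ℂ) (z : Fin n → ℂ) : ℝ :=
  (star z ⬝ᵥ H.mulVec z).re

/-- The ellipsoid `D_H = {ρ_H < 1}`. -/
def ellipsoid {n : ℕ} (H : Matrix (Fin n) (Fin n) ℂ) : Set (Fin n → ℂ) :=
  {z | hermForm H z < 1}

end

end BoundaryExtremal

/-!
A continuous competitor is a competitor for `u^*`, and a competitor for `u^*` is one for limits
along any inward curve, so everything reduces to bounding a competitor `u` for the limits along the
segments `ζ - t • M ζ` by `ω^c`, where `M = H` gives the normal and `M = id` the radius. Replace `u`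
by `max u (-1)`. The linear map `x ↦ x - t • M x` sends `closure D` into `D`, so `u (x - t • M x)`
is plurisubharmonic near `closure D`, where it is a decreasing limit of continuous plurisubharmonic
functions, namely its sup-convolutions. On `A` these functions converge to `-1` only pointwise as
`t ↓ 0`; by Hahn–Banach separation, the Riesz representation and dominated convergence, some
convex combination of them is uniformly close to `-1` on `A`. No value is lost at the given point
`z`, because a segment is not thin at its end point: `u (z - t • M z) > u z - ε` for arbitrarily
small `t > 0`.
-/

open InnerProductSpace
open scoped NNReal

namespace BoundaryExtremal

/-! ### The sub-mean value inequality for real functions -/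

section SubMean

variable {V : Type*} [AddCommGroup V] [Module ℂ V]

/-- The sub-mean value inequality for a real function on all closed affine discs
`{a + ζ • b : ‖ζ‖ ≤ 1}` contained in `S`. It is expressed through continuous functions on the unit
circle dominating `v` on the boundary of the disc, so that neither measurability nor integrability
of `v` is needed; for upper semicontinuous `v` the infimum of their means is the mean of `v`. -/
def SubMeanOn (S : Set V) (v : V → ℝ) : Prop :=
  ∀ a b : V, (∀ ζ : ℂ, ‖ζ‖ ≤ 1 → a + ζ • b ∈ S) → ∀ g : ℂ → ℝ,
    ContinuousOn g (Metric.sphere 0 1) → (∀ ζ ∈ Metric.sphere (0 : ℂ) 1, v (a + ζ • b) ≤ g ζ) →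
    v a ≤ Real.circleAverage g 0 1

theorem circleIntegrable_unit {g : ℂ → ℝ} (hg : ContinuousOn g (Metric.sphere 0 1)) :
    CircleIntegrable g 0 1 :=
  hg.circleIntegrable zero_le_one

theorem subMeanOn_const (S : Set V) (c : ℝ) : SubMeanOn S fun _ => c := by
  intro a b _ g hg hle
  calc c = Real.circleAverage (fun _ => c) 0 1 := (Real.circleAverage_const c 0 1).symm
    _ ≤ Real.circleAverage g 0 1 :=
      Real.circleAverage_mono (circleIntegrable_const c 0 1) (circleIntegrable_unit hg)
        (by simpa only [abs_one] using hle)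

namespace SubMeanOn

variable {S T : Set V} {v w : V → ℝ}

theorem mono (hv : SubMeanOn T v) (hST : S ⊆ T) : SubMeanOn S v :=
  fun a b hab => hv a b fun ζ hζ => hST (hab ζ hζ)

theorem const_mul (hv : SubMeanOn S v) {c : ℝ} (hc : 0 < c) :
    SubMeanOn S fun z => c * v z := by
  intro a b hab g hg hle
  have h := hv a b hab (fun ζ => c⁻¹ • g ζ) (hg.const_smul c⁻¹) fun ζ hζ => by
    simpa only [smul_eq_mul, inv_mul_cancel_left₀ hc.ne'] using
      mul_le_mul_of_nonneg_left (hle ζ hζ) (inv_nonneg.2 hc.le)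
  rwa [Real.circleAverage_fun_smul, smul_eq_mul, ← div_eq_inv_mul, le_div_iff₀' hc] at h

theorem add [TopologicalSpace V] [ContinuousAdd V] [ContinuousSMul ℂ V] (hv : SubMeanOn S v)
    (hw : SubMeanOn S w) (hvc : ContinuousOn v S) : SubMeanOn S fun z => v z + w z := by
  intro a b hab g hg hle
  have hmaps : Set.MapsTo (fun ζ : ℂ => a + ζ • b) (Metric.sphere 0 1) S :=
    fun ζ hζ => hab ζ (mem_sphere_zero_iff_norm.1 hζ).le
  have hvg : ContinuousOn (fun ζ : ℂ => v (a + ζ • b)) (Metric.sphere 0 1) :=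
    hvc.comp (by fun_prop) hmaps
  have hva := hv a b hab _ hvg fun ζ _ => le_rfl
  have hwa := hw a b hab (fun ζ => g ζ - v (a + ζ • b)) (hg.sub hvg) fun ζ hζ => by
    linarith [hle ζ hζ]
  have hsub := Real.circleAverage_fun_sub (circleIntegrable_unit hg) (circleIntegrable_unit hvg)
  linarith

theorem comp_affine (hv : SubMeanOn S v) {U : Set ℂ} {z b : V}
    (hU : ∀ ζ ∈ U, z + ζ • b ∈ S) : SubMeanOn U fun ζ => v (z + ζ • b) := by
  have heq (p q ζ : ℂ) : z + (p + ζ • q) • b = z + p • b + ζ • q • b := by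
    rw [smul_eq_mul, add_smul, mul_smul, add_assoc]
  intro p q hpq g hg hle
  exact hv (z + p • b) (q • b) (fun ζ hζ => heq p q ζ ▸ hU _ (hpq ζ hζ)) g hg
    fun ζ hζ => heq p q ζ ▸ hle ζ hζ

variable {U : Set ℂ} {f g : ℂ → ℝ} {p : ℂ} {r : ℝ}

theorem le_circleAverage (hf : SubMeanOn U f) (hr : 0 ≤ r) (hU : Metric.closedBall p r ⊆ U)
    (hg : ContinuousOn g (Metric.sphere p r)) (hle : ∀ ζ ∈ Metric.sphere p r, f ζ ≤ g ζ) :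
    f p ≤ Real.circleAverage g p r := by
  have hmaps : Set.MapsTo (fun ζ : ℂ => (r : ℂ) * ζ + p) (Metric.sphere 0 1)
      (Metric.sphere p r) := fun ζ hζ => by
    simp only [mem_sphere_iff_norm, add_sub_cancel_right, norm_mul, Complex.norm_real,
      mem_sphere_zero_iff_norm.1 hζ, mul_one, Real.norm_of_nonneg hr]
  rw [Real.circleAverage_eq_circleAverage_zero_one]
  refine hf p r (fun ζ hζ => hU ?_) _ (hg.comp (by fun_prop) hmaps) fun ζ hζ => ?_
  · simpa only [mem_closedBall_iff_norm, add_sub_cancel_left, smul_eq_mul, norm_mul,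
      Complex.norm_real, Real.norm_of_nonneg hr] using mul_le_of_le_one_left hr hζ
  · simpa only [smul_eq_mul, mul_comm, add_comm] using hle _ (hmaps hζ)

theorem le_of_harmonicOnNhd (hf : SubMeanOn U f) (hr : 0 ≤ r) (hU : Metric.closedBall p r ⊆ U)
    (hg : HarmonicOnNhd g (Metric.closedBall p r))
    (hle : ∀ ζ ∈ Metric.sphere p r, f ζ ≤ g ζ) : f p ≤ g p := by
  have hcont : ContinuousOn g (Metric.sphere p r) := fun ζ hζ =>
    (hg ζ (Metric.sphere_subset_closedBall hζ)).1.continuousAt.continuousWithinAt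
  exact (hf.le_circleAverage hr hU hcont hle).trans_eq
    (InnerProductSpace.HarmonicOnNhd.circleAverage_eq (by rwa [abs_of_nonneg hr]))

end SubMeanOn

end SubMean
/-! ### The maximum principle -/

theorem le_of_forall_pos_le_add_mul {x y L : ℝ} (h : ∀ η > 0, x ≤ y + η * L) : x ≤ y := by
  have hlim : Tendsto (fun η : ℝ => y + η * L) (𝓝[>] 0) (𝓝 (y + 0 * L)) :=
    ((by fun_prop : Continuous fun η : ℝ => y + η * L).tendsto 0).mono_left nhdsWithin_le_nhds
  rw [zero_mul, add_zero] at hlim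
  exact ge_of_tendsto hlim (eventually_mem_nhdsWithin.mono h)

theorem exists_forall_le_add_mul {X : Type*} [TopologicalSpace X] {S : Set X} {f g : X → ℝ}
    {a : ℝ} (hS : IsCompact S) (hf : UpperSemicontinuousOn f S) (hg : ContinuousOn g S)
    (hg0 : ∀ x ∈ S, 0 ≤ g x) (hfg : ∀ x ∈ S, g x = 0 → f x < a) :
    ∃ K, 0 ≤ K ∧ ∀ x ∈ S, f x ≤ a + K * g x := by
  have hT : IsCompact (S ∩ f ⁻¹' Set.Ici a) := hf.isCompact_inter_preimage_Ici hS a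
  obtain hempty | hne := (S ∩ f ⁻¹' Set.Ici a).eq_empty_or_nonempty
  · refine ⟨0, le_rfl, fun x hx => ?_⟩
    rw [zero_mul, add_zero]
    exact (not_le.1 fun hax => hempty.subset ⟨hx, hax⟩).le
  obtain ⟨p, hp, hpmin⟩ := hT.exists_isMinOn hne (hg.mono Set.inter_subset_left)
  have hgp : 0 < g p := (hg0 p hp.1).lt_of_ne fun h => (hfg p hp.1 h.symm).not_ge hp.2
  obtain ⟨B, hB⟩ := hf.bddAbove_of_isCompact hS
  have haB : 0 ≤ B - a := sub_nonneg.2 (le_trans hp.2 (hB ⟨p, hp.1, rfl⟩))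
  refine ⟨(B - a) / g p, by positivity, fun x hx => ?_⟩
  have hprod : 0 ≤ (B - a) / g p * g x := mul_nonneg (by positivity) (hg0 x hx)
  obtain hfx | hfx := lt_or_ge (f x) a
  · linarith
  · calc f x ≤ a + (B - a) / g p * g p := by
          rw [div_mul_cancel₀ _ hgp.ne', add_sub_cancel]; exact hB ⟨x, hx, rfl⟩
      _ ≤ a + (B - a) / g p * g x := by gcongr; exact hpmin ⟨hx, hfx⟩

theorem harmonicOnNhd_re_mul (c : ℂ) (S : Set ℂ) : HarmonicOnNhd (fun w => (c * w).re) S :=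
  fun _ _ => AnalyticAt.harmonicAt_re (by fun_prop)

namespace SubMeanOn

variable {f h : ℂ → ℝ} {U K : Set ℂ}

/-- On a circle about `p` the function `‖w‖ ^ 2` agrees with an affine harmonic function which is
larger than `‖p‖ ^ 2` at the centre. -/
theorem not_isMaxOn_sub_add_normSq {p : ℂ} (hf : SubMeanOn U f) (hU : IsOpen U) (hp : p ∈ U)
    (hh : HarmonicOnNhd h U) {κ : ℝ} (hκ : 0 < κ) :
    ¬ IsMaxOn (fun w => f w - h w + κ * ‖w‖ ^ 2) U p := by
  intro hmax
  obtain ⟨r, hr, hrU⟩ := Metric.nhds_basis_closedBall.mem_iff.1 (hU.mem_nhds hp)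
  let g : ℂ → ℝ := fun w => h w + (f p - h p + κ * (2 * ‖p‖ ^ 2 - r ^ 2)) -
    (2 * κ * starRingEnd ℂ p * w).re
  have hre (w : ℂ) : (2 * κ * starRingEnd ℂ p * w).re = κ * (‖w‖ ^ 2 + ‖p‖ ^ 2 - ‖w - p‖ ^ 2) := by
    simp only [Complex.sq_norm, Complex.normSq_apply, Complex.mul_re, Complex.mul_im,
      Complex.sub_re, Complex.sub_im, Complex.conj_re, Complex.conj_im, Complex.ofReal_re,
      Complex.ofReal_im, Complex.re_ofNat, Complex.im_ofNat]
    ring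
  have hg : HarmonicOnNhd g (Metric.closedBall p r) :=
    ((hh.mono hrU).add (harmonicOnNhd_const _)).sub (harmonicOnNhd_re_mul _ _)
  have hle : ∀ w ∈ Metric.sphere p r, f w ≤ g w := fun w hw => by
    have hfw : f w - h w + κ * ‖w‖ ^ 2 ≤ f p - h p + κ * ‖p‖ ^ 2 :=
      hmax (hrU (Metric.sphere_subset_closedBall hw))
    simp only [g, hre, mem_sphere_iff_norm.1 hw]
    linarith
  have hfp := hf.le_of_harmonicOnNhd hr.le hrU hg hle
  have hκr : 0 < κ * r ^ 2 := by positivity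
  simp only [g, hre, sub_self, norm_zero] at hfp
  linarith

theorem le_harmonic_of_le_on_diff (hf : SubMeanOn U f) (hK : IsCompact K)
    (husc : UpperSemicontinuousOn f K) (hU : IsOpen U) (hUK : U ⊆ K) (hh : HarmonicOnNhd h U)
    (hhc : ContinuousOn h K) (hle : ∀ w ∈ K \ U, f w ≤ h w) {z : ℂ} (hz : z ∈ K) :
    f z ≤ h z := by
  obtain ⟨B, hB⟩ := hK.bddAbove_image (f := fun w : ℂ => ‖w‖ ^ 2) (by fun_prop)
  refine le_of_forall_pos_le_add_mul (L := B) fun κ hκ => ?_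
  have hcont : ContinuousOn (fun w => -h w + κ * ‖w‖ ^ 2) K := by fun_prop
  obtain ⟨p, hpK, hp⟩ :=
    (husc.add hcont.upperSemicontinuousOn).exists_isMaxOn ⟨z, hz⟩ hK
  have hmax : IsMaxOn (fun w => f w - h w + κ * ‖w‖ ^ 2) K p := fun w hw => by
    simpa only [sub_eq_add_neg, add_assoc] using hp hw
  have hpU : p ∉ U := fun hpU =>
    hf.not_isMaxOn_sub_add_normSq hU hpU hh hκ (hmax.on_subset hUK)
  have hzp : f z - h z + κ * ‖z‖ ^ 2 ≤ f p - h p + κ * ‖p‖ ^ 2 := hmax hz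
  have hfp : f p ≤ h p := hle p ⟨hpK, hpU⟩
  have hpB : κ * ‖p‖ ^ 2 ≤ κ * B := by gcongr; exact hB ⟨p, hpK, rfl⟩
  have hz0 : 0 ≤ κ * ‖z‖ ^ 2 := by positivity
  linarith

end SubMeanOn

/-! ### A segment is not thin at its end points -/

/-- The real part of the principal square root, a harmonic function on the slit plane which is
continuous on `ℂ` and vanishes exactly on the slit. -/
noncomputable def slitBarrier (z : ℂ) : ℝ :=
  (z ^ (2⁻¹ : ℂ)).re

theorem slitBarrier_eq_sqrt (z : ℂ) : slitBarrier z = √((‖z‖ + z.re) / 2) :=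
  Complex.cpow_inv_two_re z

theorem slitBarrier_nonneg (z : ℂ) : 0 ≤ slitBarrier z :=
  slitBarrier_eq_sqrt z ▸ Real.sqrt_nonneg _

theorem continuous_slitBarrier : Continuous slitBarrier := by
  rw [funext slitBarrier_eq_sqrt]
  fun_prop

theorem harmonicOnNhd_slitBarrier : HarmonicOnNhd slitBarrier Complex.slitPlane :=
  fun _ hz => AnalyticAt.harmonicAt_re (analyticAt_id.cpow analyticAt_const hz)

theorem eq_neg_ofReal_norm_of_not_mem_slitPlane {z : ℂ} (hz : z ∉ Complex.slitPlane) :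
    z = -(‖z‖ : ℂ) := by
  have hle : z ≤ 0 := by simpa only [Complex.mem_slitPlane_iff_not_le_zero, not_not] using hz
  have hnorm := Complex.norm_of_nonneg' (neg_nonneg.2 hle)
  rw [norm_neg] at hnorm
  rw [hnorm, neg_neg]

theorem eq_neg_ofReal_norm_of_slitBarrier_eq_zero {z : ℂ} (hz : slitBarrier z = 0) :
    z = -(‖z‖ : ℂ) := by
  rw [slitBarrier_eq_sqrt, Real.sqrt_eq_zero'] at hz
  have hre : z.re = -‖z‖ := by
    linarith [neg_le_of_abs_le (Complex.abs_re_le_norm z)]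
  have him : z.im = 0 := by
    rw [← Complex.abs_re_eq_norm, hre, abs_neg, abs_norm]
  exact Complex.ext (by simpa only [Complex.neg_re, Complex.ofReal_re] using hre)
    (by simpa only [Complex.neg_im, Complex.ofReal_im, neg_zero] using him)

theorem harmonicOnNhd_slitBarrier_log (a K η R : ℝ) :
    HarmonicOnNhd (fun w => a + K * slitBarrier w + η * (Real.log R - Real.log ‖w‖))
      Complex.slitPlane :=
  ((harmonicOnNhd_const a).add harmonicOnNhd_slitBarrier.const_smul).add
    ((harmonicOnNhd_const (Real.log R)).sub fun _ hw =>
      analyticAt_id.harmonicAt_log_norm (Complex.slitPlane_ne_zero hw)).const_smul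

theorem continuousOn_slitBarrier_log (a K η R : ℝ) :
    ContinuousOn (fun w => a + K * slitBarrier w + η * (Real.log R - Real.log ‖w‖)) {0}ᶜ := by
  have hlog : ContinuousOn (fun w : ℂ => Real.log ‖w‖) {0}ᶜ :=
    continuous_norm.continuousOn.log fun _ hw => norm_ne_zero_iff.2 hw
  have hbar := continuous_slitBarrier.continuousOn (s := {0}ᶜ)
  fun_prop

namespace SubMeanOn

variable {f : ℂ → ℝ} {R a c K : ℝ}

/-- The logarithmic term beats the bounded function `f` near `0`, and the square root handles the
two sides of the slit, so the maximum principle applies on a slit annulus. -/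
theorem le_add_mul_slitBarrier_add_mul_log (hf : SubMeanOn (Metric.closedBall 0 R) f)
    (husc : UpperSemicontinuousOn f (Metric.closedBall 0 R)) (hK : 0 ≤ K)
    (hslit : ∀ s ∈ Set.Ioc 0 R, f (-(s : ℂ)) ≤ a)
    (hsphere : ∀ w ∈ Metric.sphere 0 R, f w ≤ a + K * slitBarrier w) {z : ℂ} (hz0 : z ≠ 0)
    (hzR : z ∈ Metric.closedBall 0 R) {η : ℝ} (hη : 0 < η) :
    f z ≤ a + K * slitBarrier z + η * (Real.log R - Real.log ‖z‖) := by
  obtain ⟨B, hB⟩ := husc.bddAbove_of_isCompact (isCompact_closedBall 0 R)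
  have hlog : ∀ᶠ ρ in 𝓝[>] (0 : ℝ), Real.log ρ < Real.log R - (B - a) / η :=
    Real.tendsto_log_nhdsGT_zero.eventually_lt_atBot _
  obtain ⟨ρ, hρlog, hρ0, hρz⟩ := (hlog.and (Ioo_mem_nhdsGT (norm_pos_iff.2 hz0))).exists
  have hBρ : B ≤ a + η * (Real.log R - Real.log ρ) := by
    have := (div_le_iff₀' hη).1 (le_sub_comm.1 hρlog.le)
    linarith
  let S : Set ℂ := Metric.closedBall 0 R ∩ {w | ρ ≤ ‖w‖}
  let U : Set ℂ := Complex.slitPlane ∩ (Metric.ball 0 R ∩ {w | ρ < ‖w‖})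
  have hS : IsCompact S :=
    (isCompact_closedBall 0 R).inter_right (isClosed_le continuous_const continuous_norm)
  have hU : IsOpen U := Complex.isOpen_slitPlane.inter
    (Metric.isOpen_ball.inter (isOpen_lt continuous_const continuous_norm))
  have hUS : U ⊆ S := fun w hw =>
    ⟨Metric.ball_subset_closedBall hw.2.1, (show ρ < ‖w‖ from hw.2.2).le⟩
  refine (hf.mono (hUS.trans Set.inter_subset_left)).le_harmonic_of_le_on_diff hS
    (husc.mono Set.inter_subset_left) hU hUS
    ((harmonicOnNhd_slitBarrier_log a K η R).mono Set.inter_subset_left)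
    ((continuousOn_slitBarrier_log a K η R).mono fun w hw => norm_pos_iff.1 (hρ0.trans_le hw.2))
    (fun w hw => ?_) ⟨hzR, hρz.le⟩
  obtain ⟨⟨hwR, hρw : ρ ≤ ‖w‖⟩, hwU⟩ := hw
  have hwR' : ‖w‖ ≤ R := mem_closedBall_zero_iff.1 hwR
  have hw0 : 0 < ‖w‖ := hρ0.trans_le hρw
  have hbar : 0 ≤ K * slitBarrier w := mul_nonneg hK (slitBarrier_nonneg w)
  have hlogw : 0 ≤ η * (Real.log R - Real.log ‖w‖) :=
    mul_nonneg hη.le (sub_nonneg.2 (Real.log_le_log hw0 hwR'))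
  by_cases hwslit : w ∈ Complex.slitPlane
  · obtain hwR' | hwR' := hwR'.eq_or_lt
    · linarith [hsphere w (mem_sphere_zero_iff_norm.2 hwR')]
    · have hwρ : ‖w‖ = ρ := by
        refine hρw.antisymm' (not_lt.1 fun h => hwU ⟨hwslit, ?_, h⟩)
        exact mem_ball_zero_iff.2 hwR'
      have hfB : f w ≤ B := hB ⟨w, hwR, rfl⟩
      rw [hwρ]
      linarith
  · have hfw := hslit ‖w‖ ⟨hw0, hwR'⟩
    rw [← eq_neg_ofReal_norm_of_not_mem_slitPlane hwslit] at hfw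
    linarith

theorem le_add_mul_slitBarrier (hf : SubMeanOn (Metric.closedBall 0 R) f)
    (husc : UpperSemicontinuousOn f (Metric.closedBall 0 R)) (hK : 0 ≤ K)
    (hslit : ∀ s ∈ Set.Ioc 0 R, f (-(s : ℂ)) ≤ a)
    (hsphere : ∀ w ∈ Metric.sphere 0 R, f w ≤ a + K * slitBarrier w) {z : ℂ} (hz0 : z ≠ 0)
    (hzR : z ∈ Metric.closedBall 0 R) : f z ≤ a + K * slitBarrier z :=
  le_of_forall_pos_le_add_mul fun _ hη =>
    hf.le_add_mul_slitBarrier_add_mul_log husc hK hslit hsphere hz0 hzR hη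

theorem le_of_le_on_segment (hf : SubMeanOn (Metric.closedBall 0 R) f)
    (husc : UpperSemicontinuousOn f (Metric.closedBall 0 R)) (hR : 0 < R)
    (hslit : ∀ s ∈ Set.Ioc 0 R, f (-(s : ℂ)) ≤ c) : f 0 ≤ c := by
  refine le_of_forall_pos_le_add fun ε hε => ?_
  obtain ⟨K, hK, hsphere⟩ := exists_forall_le_add_mul (a := c + ε) (isCompact_sphere (0 : ℂ) R)
    (husc.mono Metric.sphere_subset_closedBall) continuous_slitBarrier.continuousOn
    (fun w _ => slitBarrier_nonneg w) fun w hw hw0 => by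
      rw [eq_neg_ofReal_norm_of_slitBarrier_eq_zero hw0, mem_sphere_zero_iff_norm.1 hw]
      linarith [hslit R ⟨hR, le_rfl⟩]
  have hcircle : ∀ r ∈ Set.Ioc 0 R, f 0 ≤ c + ε + K * √r := fun r hr => by
    refine (hf.mono (Metric.closedBall_subset_closedBall hr.2)).le_of_harmonicOnNhd hr.1.le
      Set.Subset.rfl (harmonicOnNhd_const _) fun w hw => ?_
    have hwr : ‖w‖ = r := mem_sphere_zero_iff_norm.1 hw
    calc f w ≤ c + ε + K * slitBarrier w :=
          hf.le_add_mul_slitBarrier husc hK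
            (fun s hs => (hslit s hs).trans (le_add_of_nonneg_right hε.le)) hsphere
            (norm_pos_iff.1 (hwr ▸ hr.1)) (mem_closedBall_zero_iff.2 (hwr ▸ hr.2))
      _ ≤ c + ε + K * √r := by
          rw [slitBarrier_eq_sqrt, hwr]
          gcongr
          linarith [hwr ▸ Complex.re_le_norm w]
  have hlim : Tendsto (fun r => c + ε + K * √r) (𝓝[>] 0) (𝓝 (c + ε + K * √0)) :=
    ((by fun_prop : Continuous fun r => c + ε + K * √r).tendsto 0).mono_left nhdsWithin_le_nhds
  rw [Real.sqrt_zero, mul_zero, add_zero] at hlim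
  exact ge_of_tendsto hlim (Filter.mem_of_superset (Ioc_mem_nhdsGT hR) hcircle)

variable {V : Type*} [NormedAddCommGroup V] [NormedSpace ℂ V] {D : Set V} {v : V → ℝ}

theorem frequently_lt_along_segment (hv : SubMeanOn D v) (hD : IsOpen D)
    (husc : UpperSemicontinuousOn v D) {z : V} (hz : z ∈ D) (b : V) {c : ℝ} (hc : c < v z) :
    ∃ᶠ t : ℝ in 𝓝[>] 0, c < v (z - (t : ℂ) • b) := by
  intro hev
  obtain ⟨δ, hδ, hsegment⟩ := mem_nhdsGT_iff_exists_Ioc_subset.1 hev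
  have hcont : Continuous fun ζ : ℂ => z + ζ • b := by fun_prop
  have hnhds : {ζ : ℂ | z + ζ • b ∈ D} ∈ 𝓝 (0 : ℂ) :=
    (hD.preimage hcont).mem_nhds (by simpa only [Set.mem_preimage, zero_smul, add_zero] using hz)
  obtain ⟨R, hR, hRD⟩ := Metric.nhds_basis_closedBall.mem_iff.1 hnhds
  have hdisc : ∀ ζ ∈ Metric.closedBall (0 : ℂ) (min R δ), z + ζ • b ∈ D := fun ζ hζ =>
    hRD (Metric.closedBall_subset_closedBall (min_le_left R δ) hζ)
  have hz_le : v (z + (0 : ℂ) • b) ≤ c :=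
    (hv.comp_affine hdisc).le_of_le_on_segment (husc.comp hcont.continuousOn hdisc)
      (lt_min hR hδ) fun s hs => by
        rw [neg_smul, ← sub_eq_add_neg]
        exact not_lt.1 (hsegment ⟨hs.1, hs.2.trans (min_le_right R δ)⟩)
  rw [zero_smul, add_zero] at hz_le
  exact hz_le.not_gt hc

end SubMeanOn

/-! ### Regularization by sup-convolution -/

section SupConvolution

variable {E : Type*} [PseudoMetricSpace E] {D : Set E} {v : E → ℝ} {j : ℝ≥0}

/-- The sup-convolution of `v` on `D` with the cone of slope `j`: for `v` bounded above on `D`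
nonempty, the least function on the whole space that dominates `v` on `D` and is Lipschitz with
constant `j`. -/
noncomputable def supConvolution (D : Set E) (v : E → ℝ) (j : ℝ≥0) (x : E) : ℝ :=
  ⨆ w : D, (v w - j * dist (w : E) x)

theorem le_supConvolution (hv : BddAbove (v '' D)) (j : ℝ≥0) (x : E) {w : E} (hw : w ∈ D) :
    v w - j * dist w x ≤ supConvolution D v j x := by
  obtain ⟨B, hB⟩ := hv
  refine le_ciSup (f := fun w : D => v w - j * dist (w : E) x) ⟨B, ?_⟩ ⟨w, hw⟩
  rintro _ ⟨y, rfl⟩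
  exact (sub_le_self _ (by positivity)).trans (hB ⟨y, y.2, rfl⟩)

theorem self_le_supConvolution (hv : BddAbove (v '' D)) (j : ℝ≥0) {x : E} (hx : x ∈ D) :
    v x ≤ supConvolution D v j x := by
  simpa only [dist_self, mul_zero, sub_zero] using le_supConvolution hv j x hx

theorem supConvolution_nonpos (hv : ∀ x ∈ D, v x ≤ 0) (j : ℝ≥0) (x : E) :
    supConvolution D v j x ≤ 0 :=
  Real.iSup_nonpos fun w => (sub_le_self _ (by positivity)).trans (hv w w.2)

theorem lipschitzWith_supConvolution (hv : BddAbove (v '' D)) (j : ℝ≥0) :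
    LipschitzWith j (supConvolution D v j) := by
  refine LipschitzWith.of_le_add_mul j fun x y => ?_
  obtain hD | hD := isEmpty_or_nonempty D
  · simp only [supConvolution, Real.iSup_of_isEmpty, zero_add]
    positivity
  refine ciSup_le fun w => ?_
  calc v w - j * dist (w : E) x
      ≤ v w - j * dist (w : E) y + j * dist x y := by
        linarith [mul_le_mul_of_nonneg_left (dist_triangle (w : E) x y) j.coe_nonneg]
    _ ≤ supConvolution D v j y + j * dist x y := by
        gcongr
        exact le_supConvolution hv j y w.2

theorem tendsto_supConvolution (hv : BddAbove (v '' D)) {x : E} (hx : x ∈ D)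
    (husc : UpperSemicontinuousWithinAt v D x) :
    Tendsto (fun j => supConvolution D v j x) atTop (𝓝 (v x)) := by
  have : Nonempty D := ⟨⟨x, hx⟩⟩
  refine tendsto_order.2 ⟨fun c hc => Eventually.of_forall fun j =>
    hc.trans_le (self_le_supConvolution hv j hx), fun c hc => ?_⟩
  obtain ⟨c', hvc', hc'c⟩ := exists_between hc
  obtain ⟨δ, hδ, hball⟩ := Metric.mem_nhdsWithin_iff.1 (husc c' hvc')
  obtain ⟨B, hB⟩ := hv
  have hfar : ∀ᶠ j : ℝ≥0 in atTop, B - c' ≤ j * δ :=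
    (NNReal.tendsto_coe_atTop.2 tendsto_id |>.atTop_mul_const hδ).eventually_ge_atTop _
  filter_upwards [hfar] with j hj
  refine (ciSup_le fun w => ?_).trans_lt hc'c
  obtain hw | hw := lt_or_ge (dist (w : E) x) δ
  · exact (sub_le_self _ (by positivity)).trans (le_of_lt (hball ⟨hw, w.2⟩))
  · have hvw : v w ≤ B := hB ⟨w, w.2, rfl⟩
    have hjw : j * δ ≤ j * dist (w : E) x := by gcongr
    linarith

end SupConvolution

section SupConvolutionSubMean

variable {V W : Type*} [NormedAddCommGroup V] [NormedSpace ℂ V] [NormedAddCommGroup W]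
  [NormedSpace ℂ W] {D : Set W} {v : W → ℝ}

/-- A point far from `T x` cannot contribute to the supremum at `T x`, and near points can be
translated along with the disc. -/
theorem SubMeanOn.supConvolution_comp (hv : SubMeanOn D v) (hb : BddAbove (v '' D)) {S : Set V}
    {T : V →ₗ[ℂ] W} {δ : ℝ} (hδ : 0 < δ) (hT : ∀ x ∈ S, Metric.ball (T x) δ ⊆ D) {j : ℝ≥0}
    (hosc : ∀ x ∈ D, ∀ y ∈ D, v y - v x ≤ j * δ) :
    SubMeanOn S fun x => supConvolution D v j (T x) := by
  intro a b hab g hg hle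
  have hTD : ∀ x ∈ S, T x ∈ D := fun x hx => hT x hx (Metric.mem_ball_self hδ)
  have ha : a ∈ S := by simpa only [zero_smul, add_zero] using hab 0 (by simp)
  have : Nonempty D := ⟨⟨T a, hTD a ha⟩⟩
  refine ciSup_le fun ⟨w, hw⟩ => ?_
  have hshift (ζ : ℂ) : dist (w + ζ • T b) (T (a + ζ • b)) = dist w (T a) := by
    rw [map_add, map_smul, dist_add_right]
  obtain hnear | hfar := lt_or_ge (dist w (T a)) δ
  · have hdisc : ∀ ζ : ℂ, ‖ζ‖ ≤ 1 → w + ζ • T b ∈ D := fun ζ hζ =>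
      hT _ (hab ζ hζ) (by rwa [Metric.mem_ball, hshift])
    have hmean := ((subMeanOn_const D (-(j * dist w (T a)))).add hv continuousOn_const)
      w (T b) hdisc g hg fun ζ hζ => by
        have hx := hdisc ζ (mem_sphere_zero_iff_norm.1 hζ).le
        have := le_supConvolution hb j (T (a + ζ • b)) hx
        rw [hshift] at this
        linarith [hle ζ hζ]
    linarith
  · refine subMeanOn_const S _ a b hab g hg fun ζ hζ => ?_
    have hx := hTD _ (hab ζ (mem_sphere_zero_iff_norm.1 hζ).le)
    have hjδ : j * δ ≤ j * dist w (T a) := by gcongr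
    linarith [hosc _ hx w hw, self_le_supConvolution hb j hx, hle ζ hζ]

end SupConvolutionSubMean

/-! ### Convex combinations of pointwise limits -/

section ConvexCombination

theorem map_nonneg_of_forall_lt {X : Type*} [TopologicalSpace X] {L : C(X, ℝ) →ₗ[ℝ] ℝ}
    {ε s : ℝ} (hε : 0 < ε) (hL : ∀ f : C(X, ℝ), (∀ x, f x < ε) → L f < s) {g : C(X, ℝ)}
    (hg : 0 ≤ g) : 0 ≤ L g := by
  by_contra! hneg
  have hs : 0 < s := by
    simpa only [map_zero] using hL 0 fun _ => hε
  have hLg := hL ((s / L g) • g) fun x =>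
    (mul_nonpos_of_nonpos_of_nonneg (div_neg_of_pos_of_neg hs hneg).le (hg x)).trans_lt hε
  rw [map_smul, smul_eq_mul, div_mul_cancel₀ _ hneg.ne] at hLg
  exact hLg.false

variable {X : Type*} [TopologicalSpace X] [T2Space X] [CompactSpace X] {C : Set C(X, ℝ)}
  {ε : ℝ}

theorem exists_measure_integral_eq [MeasurableSpace X] [BorelSpace X] (L : C(X, ℝ) →ₗ[ℝ] ℝ)
    (hL : ∀ g : C(X, ℝ), 0 ≤ g → 0 ≤ L g) :
    ∃ μ : Measure X, IsFiniteMeasure μ ∧ ∀ f : C(X, ℝ), ∫ x, f x ∂μ = L f := by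
  let Λ : CompactlySupportedContinuousMap X ℝ →ₚ[ℝ] ℝ :=
    PositiveLinearMap.mk₀
      { toFun := fun f => L (f : C(X, ℝ))
        map_add' := fun f g => L.map_add f g
        map_smul' := fun a f => L.map_smul a f }
      fun f hf => hL f fun x => hf x
  exact ⟨RealRMK.rieszMeasure Λ, inferInstance, fun f => RealRMK.integral_rieszMeasure Λ
    (CompactlySupportedContinuousMap.continuousMapEquiv f)⟩

theorem exists_measure_le_integral [MeasurableSpace X] [BorelSpace X] (hC : Convex ℝ C)
    (hε : 0 < ε) (hCε : ∀ f ∈ C, ∃ x, ε ≤ f x) :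
    ∃ μ : Measure X, IsFiniteMeasure μ ∧ ∃ s : ℝ, 0 < s ∧ ∀ f ∈ C, s ≤ ∫ x, f x ∂μ := by
  let O : Set C(X, ℝ) := {f | ∀ x, f x < ε}
  have hOopen : IsOpen O := by
    simpa only [Set.MapsTo, Set.mem_univ, true_imp_iff, Set.mem_Iio] using
      ContinuousMap.isOpen_setOfPred_mapsTo (X := X) isCompact_univ (isOpen_Iio (a := ε))
  have hOconvex : Convex ℝ O := fun f hf g hg a b ha hb hab x =>
    convex_Iio ε (hf x) (hg x) ha hb hab
  have hdisj : Disjoint O C := Set.disjoint_left.2 fun f hfO hfC =>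
    let ⟨x, hx⟩ := hCε f hfC
    (hfO x).not_ge hx
  obtain ⟨L, s, hLO, hLC⟩ := geometric_hahn_banach_open hOconvex hOopen hC hdisj
  have hs : 0 < s := by
    simpa only [map_zero] using hLO 0 fun _ => hε
  obtain ⟨μ, hμ, hμL⟩ := exists_measure_integral_eq (L : C(X, ℝ) →ₗ[ℝ] ℝ)
    fun _ hg => map_nonneg_of_forall_lt hε hLO hg
  exact ⟨μ, hμ, s, hs, fun f hf => (hLC f hf).trans_eq (hμL f).symm⟩

theorem exists_mem_forall_lt_of_tendsto (hC : Convex ℝ C) {φ : ℕ → ℕ → C(X, ℝ)}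
    {ψ : ℕ → X → ℝ} {B : ℝ} (hφC : ∀ k j, φ k j ∈ C) (hφB : ∀ k j x, |φ k j x| ≤ B)
    (hφψ : ∀ k x, Tendsto (fun j => φ k j x) atTop (𝓝 (ψ k x)))
    (hψ : ∀ x, Tendsto (fun k => ψ k x) atTop (𝓝 0)) (hε : 0 < ε) :
    ∃ f ∈ C, ∀ x, f x < ε := by
  borelize X
  by_contra! hCε
  obtain ⟨μ, hμ, s, hs, hsC⟩ := exists_measure_le_integral hC hε hCε
  have hψmeas (k : ℕ) : AEStronglyMeasurable (ψ k) μ :=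
    aestronglyMeasurable_of_tendsto_ae atTop (fun j => (φ k j).continuous.aestronglyMeasurable)
      (Eventually.of_forall (hφψ k))
  have hψB (k : ℕ) (x : X) : |ψ k x| ≤ B :=
    le_of_tendsto' (hφψ k x).abs fun j => hφB k j x
  have hsψ (k : ℕ) : s ≤ ∫ x, ψ k x ∂μ := by
    refine ge_of_tendsto' (tendsto_integral_of_dominated_convergence (fun _ => B)
      (fun j => (φ k j).continuous.aestronglyMeasurable) (integrable_const B)
      (fun j => Eventually.of_forall (hφB k j)) (Eventually.of_forall (hφψ k))) fun j => ?_
    exact hsC _ (hφC k j)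
  have hlim : Tendsto (fun k => ∫ x, ψ k x ∂μ) atTop (𝓝 (∫ _, (0 : ℝ) ∂μ)) :=
    tendsto_integral_of_dominated_convergence (fun _ => B) hψmeas (integrable_const B)
      (fun k => Eventually.of_forall (hψB k)) (Eventually.of_forall hψ)
  rw [integral_zero] at hlim
  exact hs.not_ge (ge_of_tendsto' hlim hsψ)

end ConvexCombination

/-! ### Approximation by continuous functions -/

section Approximation

variable {V : Type*} [NormedAddCommGroup V] [NormedSpace ℂ V] {D A : Set V} {v : V → ℝ}

/-- The cone of non-positive real functions which are continuous on `closure D` and satisfy the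
sub-mean value inequality on `D`: the competitors of `omegaC` without the condition on `A`. -/
def continuousNegPSH (D : Set V) : ConvexCone ℝ (V → ℝ) where
  carrier := {v | ContinuousOn v (closure D) ∧ (∀ x ∈ closure D, v x ≤ 0) ∧ SubMeanOn D v}
  smul_mem' := fun c hc _ ⟨hcont, h0, hsub⟩ =>
    ⟨hcont.const_smul c, fun x hx => mul_nonpos_of_nonneg_of_nonpos hc.le (h0 x hx),
      hsub.const_mul hc⟩
  add_mem' := fun _ ⟨hcont, h0, hsub⟩ _ ⟨hcont', h0', hsub'⟩ =>
    ⟨hcont.add hcont', fun x hx => add_nonpos (h0 x hx) (h0' x hx),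
      hsub.add hsub' (hcont.mono subset_closure)⟩

theorem const_mem_continuousNegPSH (D : Set V) {c : ℝ} (hc : c ≤ 0) :
    (fun _ => c) ∈ continuousNegPSH D :=
  ⟨continuousOn_const, fun _ _ => hc, subMeanOn_const D c⟩

theorem exists_continuousNegPSH_tendsto_comp (hv : SubMeanOn D v) (hD : IsOpen D)
    (hDc : IsCompact (closure D)) (husc : UpperSemicontinuousOn v D) (hv0 : ∀ x ∈ D, v x ≤ 0)
    {m : ℝ} (hvm : ∀ x ∈ D, m ≤ v x) {T : V →L[ℂ] V} (hT : Set.MapsTo T (closure D) D) :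
    ∃ w : ℕ → V → ℝ, (∀ j, w j ∈ continuousNegPSH D) ∧
      (∀ j, ∀ x ∈ closure D, v (T x) ≤ w j x) ∧
      ∀ x ∈ closure D, Tendsto (fun j => w j x) atTop (𝓝 (v (T x))) := by
  have hb : BddAbove (v '' D) := ⟨0, Set.forall_mem_image.2 hv0⟩
  obtain ⟨δ, hδ, hδD⟩ := (hDc.image T.continuous).exists_thickening_subset_open hD
    (Set.image_subset_iff.2 hT)
  have hball : ∀ x ∈ D, Metric.ball (T x) δ ⊆ D := fun x hx =>
    (Metric.ball_subset_thickening (Set.mem_image_of_mem T (subset_closure hx)) δ).trans hδD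
  obtain ⟨N, hN⟩ := exists_nat_ge (-m / δ)
  have hosc (j : ℕ) : ∀ x ∈ D, ∀ y ∈ D, v y - v x ≤ ((N + j : ℕ) : ℝ≥0) * δ := by
    intro x hx y hy
    have hNδ : -m ≤ N * δ := (div_le_iff₀ hδ).1 hN
    have hjδ : 0 ≤ j * δ := by positivity
    push_cast
    linarith [hv0 y hy, hvm x hx]
  refine ⟨fun j x => supConvolution D v (N + j : ℕ) (T x), fun j => ⟨?_, fun x _ => ?_, ?_⟩,
    fun j x hx => self_le_supConvolution hb _ (hT hx), fun x hx => ?_⟩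
  · exact ((lipschitzWith_supConvolution hb _).continuous.comp T.continuous).continuousOn
  · exact supConvolution_nonpos hv0 _ _
  · exact hv.supConvolution_comp (T := (T : V →ₗ[ℂ] V)) hb hδ hball (hosc j)
  · exact (tendsto_supConvolution hb (hT hx) (husc _ (hT hx))).comp
      (tendsto_natCast_atTop_atTop.comp (tendsto_add_atTop_nat N |>.congr fun j => add_comm j N))

theorem exists_mem_continuousNegPSH_lt_on (hv : SubMeanOn D v) (hD : IsOpen D)
    (hDc : IsCompact (closure D)) (husc : UpperSemicontinuousOn v D) (hv0 : ∀ x ∈ D, v x ≤ 0)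
    (hv1 : ∀ x ∈ D, -1 ≤ v x) (hA : IsCompact A) (hAD : A ⊆ closure D) {T : ℕ → V →L[ℂ] V}
    (hT : ∀ k, Set.MapsTo (T k) (closure D) D)
    (hlim : ∀ ζ ∈ A, Tendsto (fun k => v (T k ζ)) atTop (𝓝 (-1))) {z : V} (hz : z ∈ D) {s : ℝ}
    (hs : ∀ k, s ≤ v (T k z)) {ε : ℝ} (hε : 0 < ε) :
    ∃ w ∈ continuousNegPSH D, s ≤ w z ∧ ∀ ζ ∈ A, w ζ < -1 + ε := by
  have : CompactSpace A := isCompact_iff_compactSpace.1 hA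
  let C : Set C(A, ℝ) := {f | ∃ w ∈ continuousNegPSH D, s ≤ w z ∧ ∀ a : A, f a = w a + 1}
  have hC : Convex ℝ C := by
    rintro f ⟨w, hw, hwz, hfw⟩ g ⟨y, hy, hyz, hgy⟩ α β hα hβ hαβ
    refine ⟨α • w + β • y, (continuousNegPSH D).convex hw hy hα hβ hαβ,
      convex_Ici s hwz hyz hα hβ hαβ, fun a => ?_⟩
    simp only [ContinuousMap.add_apply, ContinuousMap.smul_apply, hfw, hgy, Pi.add_apply,
      Pi.smul_apply, smul_eq_mul]
    linear_combination hαβ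
  choose w hwmem hvw hwlim using fun k =>
    exists_continuousNegPSH_tendsto_comp hv hD hDc husc hv0 hv1 (hT k)
  let φ (k j : ℕ) : C(A, ℝ) :=
    ⟨fun a => w k j a + 1,
      ((hwmem k j).1.mono hAD).domRestrict.add continuous_const⟩
  have hφ (k j : ℕ) : φ k j ∈ C :=
    ⟨w k j, hwmem k j, (hs k).trans (hvw k j z (subset_closure hz)), fun _ => rfl⟩
  have hφB (k j : ℕ) (a : A) : |φ k j a| ≤ 1 := by
    have ha := hAD a.2
    have hupper : w k j a ≤ 0 := (hwmem k j).2.1 a ha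
    have hlower : -1 ≤ w k j a := (hv1 _ (hT k ha)).trans (hvw k j a ha)
    exact abs_le.2 ⟨show -1 ≤ w k j a + 1 by linarith, show w k j a + 1 ≤ 1 by linarith⟩
  obtain ⟨f, ⟨w₀, hw₀, hw₀z, hfw⟩, hf⟩ := exists_mem_forall_lt_of_tendsto hC hφ hφB
    (ψ := fun k a => v (T k a) + 1) (fun k a => (hwlim k a (hAD a.2)).add_const 1)
    (fun a => by simpa only [neg_add_cancel] using (hlim a a.2).add_const 1) hε
  refine ⟨w₀, hw₀, hw₀z, fun ζ hζ => ?_⟩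
  linarith [hf ⟨ζ, hζ⟩, hfw ⟨ζ, hζ⟩]

/-- The linear vector field `-M` points strictly into `D`: for all small `t > 0`, uniformly on
`closure D`, the map `x ↦ x - t • M x` sends `closure D` into `D`. -/
def IsInward (D : Set V) (M : V →L[ℂ] V) : Prop :=
  ∀ᶠ t : ℝ in 𝓝[>] 0, ∀ x ∈ closure D, x - (t : ℂ) • M x ∈ D

theorem exists_mem_continuousNegPSH_le_on (hv : SubMeanOn D v) (hD : IsOpen D)
    (hDc : IsCompact (closure D)) (husc : UpperSemicontinuousOn v D) (hv0 : ∀ x ∈ D, v x ≤ 0)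
    (hv1 : ∀ x ∈ D, -1 ≤ v x) (hA : IsCompact A) (hAD : A ⊆ closure D) {M : V →L[ℂ] V}
    (hM : IsInward D M)
    (hlim : ∀ ζ ∈ A, Tendsto (fun t : ℝ => v (ζ - (t : ℂ) • M ζ)) (𝓝[>] 0) (𝓝 (-1))) {z : V}
    (hz : z ∈ D) {c : ℝ} (hc : c < v z) :
    ∃ w ∈ continuousNegPSH D, c ≤ w z ∧ ∀ ζ ∈ A, w ζ ≤ -1 := by
  obtain ⟨s, hcs, hsv⟩ := exists_between hc
  have hfreq := (hv.frequently_lt_along_segment hD husc hz (M z) hsv).and_eventually hM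
  obtain ⟨t, ht, htk⟩ := exists_seq_forall_of_frequently hfreq
  obtain ⟨w, hw, hwz, hwA⟩ := exists_mem_continuousNegPSH_lt_on
    (T := fun k => ContinuousLinearMap.id ℂ V - (t k : ℂ) • M) hv hD hDc husc hv0 hv1 hA hAD
    (fun k => (htk k).2) (fun ζ hζ => (hlim ζ hζ).comp ht) hz (fun k => (htk k).1.le)
    (sub_pos.2 hcs)
  refine ⟨_, (continuousNegPSH D).add_mem hw
    (const_mem_continuousNegPSH D (c := c - s) (by linarith)), ?_, fun ζ hζ => ?_⟩
  · simp only [Pi.add_apply]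
    linarith
  · simp only [Pi.add_apply]
    linarith [hwA ζ hζ]

end Approximation

/-! ### Real functions and extended real plurisubharmonic functions -/

section Truncation

theorem unitIntegral_mono {f g : ℝ → EReal} (hfg : ∀ t, f t ≤ g t) :
    unitIntegral f ≤ unitIntegral g :=
  EReal.sub_le_sub
    (EReal.coe_ennreal_le_coe_ennreal_iff.2 <| lintegral_mono fun t =>
      EReal.toENNReal_le_toENNReal (hfg t))
    (EReal.coe_ennreal_le_coe_ennreal_iff.2 <| lintegral_mono fun t =>
      EReal.toENNReal_le_toENNReal (EReal.neg_le_neg_iff.2 (hfg t)))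

theorem unitIntegral_coe {f : ℝ → ℝ} (hf : IntegrableOn f (Set.Icc 0 1)) :
    unitIntegral (fun t => (f t : EReal)) = (∫ t in Set.Icc (0 : ℝ) 1, f t : ℝ) := by
  have hneg : ∫⁻ t in Set.Icc (0 : ℝ) 1, ENNReal.ofReal (-f t) ≠ ⊤ := hf.neg.lintegral_lt_top.ne
  simp only [unitIntegral, ← EReal.coe_neg, EReal.real_coe_toENNReal]
  rw [integral_eq_lintegral_pos_part_sub_lintegral_neg_part hf, EReal.coe_sub,
    EReal.coe_ennreal_toReal hf.lintegral_lt_top.ne, EReal.coe_ennreal_toReal hneg]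

theorem exp_two_pi_mul_eq_circleMap (t : ℝ) :
    Complex.exp (2 * Real.pi * t * Complex.I) = circleMap 0 1 (2 * Real.pi * t) := by
  rw [circleMap_zero, Complex.ofReal_one, one_mul]
  push_cast
  rfl

theorem exp_two_pi_mul_mem_sphere (t : ℝ) :
    Complex.exp (2 * Real.pi * t * Complex.I) ∈ Metric.sphere (0 : ℂ) 1 :=
  exp_two_pi_mul_eq_circleMap t ▸ circleMap_mem_sphere 0 zero_le_one _

theorem unitIntegral_exp_eq_circleAverage {g : ℂ → ℝ} (hg : ContinuousOn g (Metric.sphere 0 1)) :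
    unitIntegral (fun t => (g (Complex.exp (2 * Real.pi * t * Complex.I)) : EReal)) =
      (Real.circleAverage g 0 1 : ℝ) := by
  have hcont : Continuous fun t : ℝ => g (Complex.exp (2 * Real.pi * t * Complex.I)) :=
    hg.comp_continuous (by fun_prop) exp_two_pi_mul_mem_sphere
  rw [unitIntegral_coe hcont.continuousOn.integrableOn_Icc, integral_Icc_eq_integral_Ioc,
    ← intervalIntegral.integral_of_le zero_le_one]
  simp only [exp_two_pi_mul_eq_circleMap]
  rw [intervalIntegral.integral_comp_mul_left (fun θ => g (circleMap 0 1 θ)) (by positivity),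
    mul_zero, mul_one, Real.circleAverage_def]

variable {n : ℕ} {D : Set (Fin n → ℂ)} {u : (Fin n → ℂ) → EReal} {z : Fin n → ℂ}

theorem coe_mem_PSHNeg {w : (Fin n → ℂ) → ℝ} (hw : w ∈ continuousNegPSH D) :
    (fun x => (w x : EReal)) ∈ PSHNeg D := by
  obtain ⟨hcont, h0, hsub⟩ := hw
  have hcont' := hcont.mono subset_closure
  refine ⟨⟨fun x _ => EReal.coe_lt_top _, ?_, fun a b hab => ?_⟩,
    fun x hx => EReal.coe_nonpos.2 (h0 x (subset_closure hx))⟩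
  · exact continuous_coe_real_ereal.comp_upperSemicontinuousOn hcont'.upperSemicontinuousOn
      fun x y => EReal.coe_le_coe
  · have hg : ContinuousOn (fun ζ : ℂ => w (a + ζ • b)) (Metric.sphere 0 1) :=
      hcont'.comp (by fun_prop) fun ζ hζ => hab ζ (mem_sphere_zero_iff_norm.1 hζ).le
    rw [unitIntegral_exp_eq_circleAverage hg]
    exact EReal.coe_le_coe (hsub a b hab _ hg fun ζ _ => le_rfl)

/-- The truncation `max u (-1)` of a non-positive extended real function, as a real function. Where
`u` is `⊤` it has the value `0`. -/
noncomputable def truncation (u : (Fin n → ℂ) → EReal) (z : Fin n → ℂ) : ℝ :=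
  (max (u z) (-1)).toReal

theorem coe_truncation (hu : u z ≤ 0) : (truncation u z : EReal) = max (u z) (-1) :=
  EReal.coe_toReal
    (ne_top_of_le_ne_top EReal.zero_ne_top (max_le hu (by norm_num)))
    (ne_bot_of_le_ne_bot (EReal.coe_ne_bot (-1)) (le_max_right _ _))

theorem truncation_nonpos (hu : u z ≤ 0) : truncation u z ≤ 0 := by
  rw [← EReal.coe_nonpos, coe_truncation hu]
  exact max_le hu (by norm_num)

theorem neg_one_le_truncation (hu : u z ≤ 0) : -1 ≤ truncation u z := by
  rw [← EReal.coe_le_coe_iff, coe_truncation hu]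
  exact le_max_right _ _

theorem le_coe_truncation (hu : u z ≤ 0) : u z ≤ truncation u z :=
  (le_max_left _ _).trans_eq (coe_truncation hu).symm

theorem truncation_lt (hu : u z ≤ 0) {c : ℝ} (hc : -1 < c) (h : u z < c) :
    truncation u z < c := by
  rw [← EReal.coe_lt_coe_iff, coe_truncation hu]
  exact max_lt h (EReal.coe_lt_coe_iff.2 hc)

theorem upperSemicontinuousOn_truncation (hu : u ∈ PSHNeg D) :
    UpperSemicontinuousOn (truncation u) D := by
  intro x hx c hc
  have hux : u x < c := (le_coe_truncation (hu.2 x hx)).trans_lt (EReal.coe_lt_coe_iff.2 hc)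
  filter_upwards [hu.1.usc x hx c hux, self_mem_nhdsWithin] with y hy hyD
  exact truncation_lt (hu.2 y hyD) ((neg_one_le_truncation (hu.2 x hx)).trans_lt hc) hy

theorem subMeanOn_truncation (hu : u ∈ PSHNeg D) : SubMeanOn D (truncation u) := by
  intro a b hab g hg hle
  have hD : ∀ ζ ∈ Metric.sphere (0 : ℂ) 1, a + ζ • b ∈ D := fun ζ hζ =>
    hab ζ (mem_sphere_zero_iff_norm.1 hζ).le
  have ha : a ∈ D := by
    simpa only [zero_smul, add_zero] using hab 0 (by rw [norm_zero]; exact zero_le_one)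
  rw [← EReal.coe_le_coe_iff, coe_truncation (hu.2 a ha)]
  refine max_le ?_ (EReal.coe_le_coe ?_)
  · calc u a ≤ unitIntegral fun t => u (a + Complex.exp (2 * Real.pi * t * Complex.I) • b) :=
          hu.1.sub_mean a b hab
      _ ≤ unitIntegral fun t => (g (Complex.exp (2 * Real.pi * t * Complex.I)) : EReal) :=
          unitIntegral_mono fun t =>
            have ht := exp_two_pi_mul_mem_sphere t
            (le_coe_truncation (hu.2 _ (hD _ ht))).trans (EReal.coe_le_coe (hle _ ht))
      _ = Real.circleAverage g 0 1 := unitIntegral_exp_eq_circleAverage hg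
  · exact subMeanOn_const D (-1) a b hab g hg fun ζ hζ =>
      (neg_one_le_truncation (hu.2 _ (hD ζ hζ))).trans (hle ζ hζ)

theorem tendsto_truncation_of_limsup_le {ι : Type*} {l : Filter ι} {x : ι → Fin n → ℂ}
    (hx : ∀ᶠ i in l, u (x i) ≤ 0) (hlim : limsup (fun i => u (x i)) l ≤ -1) :
    Tendsto (fun i => truncation u (x i)) l (𝓝 (-1)) := by
  refine tendsto_order.2 ⟨fun c hc => ?_, fun c hc => ?_⟩
  · filter_upwards [hx] with i hi
    exact hc.trans_le (neg_one_le_truncation hi)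
  · have hlt : limsup (fun i => u (x i)) l < c := hlim.trans_lt (EReal.coe_lt_coe_iff.2 hc)
    filter_upwards [hx, eventually_lt_of_limsup_lt hlt] with i hi hic
    exact truncation_lt hi hc hic

end Truncation

/-! ### Extremal functions with limits along a linear vector field -/

section OmegaAlong

variable {n : ℕ} {D A : Set (Fin n → ℂ)} {M : (Fin n → ℂ) →L[ℂ] (Fin n → ℂ)} {z : Fin n → ℂ}

/-- The extremal function whose boundary condition is on the upper limits along the segments
`ζ - t • M ζ`, `t ↓ 0`: it is `omegaN` for `M = H` on the ellipsoid of `H`, and `omegaR` for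
`M = id`. -/
noncomputable def omegaAlong (D : Set (Fin n → ℂ)) (M : (Fin n → ℂ) →L[ℂ] (Fin n → ℂ))
    (A : Set (Fin n → ℂ)) (z : Fin n → ℂ) : EReal :=
  sSup {x | ∃ u ∈ PSHNeg D,
    (∀ ζ ∈ A, limsup (fun t : ℝ => u (ζ - (t : ℂ) • M ζ)) (𝓝[>] 0) ≤ -1) ∧ x = u z}

theorem omegaC_le_omega (hA : A ⊆ closure D) (z : Fin n → ℂ) : omegaC D A z ≤ omega D A z := by
  refine sSup_le_sSup ?_
  rintro _ ⟨u, hu, hcont, huA, rfl⟩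
  refine ⟨_, hu, fun ζ hζ => ?_, rfl⟩
  have : (𝓝[D] ζ).NeBot := mem_closure_iff_nhdsWithin_neBot.1 (hA hζ)
  have hlim : Tendsto (fun x => (u x : EReal)) (𝓝[D] ζ) (𝓝 (u ζ)) :=
    EReal.tendsto_coe.2 ((hcont ζ (hA hζ)).mono subset_closure)
  exact hlim.limsup_eq.trans_le (EReal.coe_le_coe (huA ζ hζ))

theorem omega_le_omegaAlong (hM : IsInward D M) (hA : A ⊆ closure D) (z : Fin n → ℂ) :
    omega D A z ≤ omegaAlong D M A z := by
  refine sSup_le_sSup ?_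
  rintro _ ⟨u, hu, huA, rfl⟩
  refine ⟨u, hu, fun ζ hζ => le_trans ?_ (huA ζ hζ), rfl⟩
  have hlim : Tendsto (fun t : ℝ => ζ - (t : ℂ) • M ζ) (𝓝[>] 0) (𝓝 ζ) := by
    have hcont : Continuous fun t : ℝ => ζ - (t : ℂ) • M ζ := by fun_prop
    simpa only [Complex.ofReal_zero, zero_smul, sub_zero] using
      (hcont.tendsto 0).mono_left nhdsWithin_le_nhds
  exact limsup_le_limsup_of_le (u := u)
    (tendsto_nhdsWithin_iff.2 ⟨hlim, hM.mono fun t ht => ht ζ (hA hζ)⟩)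

theorem omegaAlong_le_omegaC (hD : IsOpen D) (hDc : IsCompact (closure D)) (hM : IsInward D M)
    (hAc : IsCompact A) (hA : A ⊆ closure D) (hz : z ∈ D) :
    omegaAlong D M A z ≤ omegaC D A z := by
  refine sSup_le ?_
  rintro _ ⟨u, hu, huA, rfl⟩
  refine (le_coe_truncation (hu.2 z hz)).trans (EReal.ge_of_forall_gt_iff_ge.1 fun c hc => ?_)
  obtain ⟨w, hw, hcw, hwA⟩ := exists_mem_continuousNegPSH_le_on (subMeanOn_truncation hu) hD hDc
    (upperSemicontinuousOn_truncation hu) (fun x hx => truncation_nonpos (hu.2 x hx))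
    (fun x hx => neg_one_le_truncation (hu.2 x hx)) hAc hA hM
    (fun ζ hζ => tendsto_truncation_of_limsup_le (hM.mono fun t ht => hu.2 _ (ht ζ (hA hζ)))
      (huA ζ hζ)) hz (EReal.coe_lt_coe_iff.1 hc)
  exact (EReal.coe_le_coe hcw).trans (le_sSup ⟨w, coe_mem_PSHNeg hw, hw.1, hwA, rfl⟩)

theorem omegaAlong_eq_omegaC (hD : IsOpen D) (hDc : IsCompact (closure D)) (hM : IsInward D M)
    (hAc : IsCompact A) (hA : A ⊆ closure D) (hz : z ∈ D) :
    omegaAlong D M A z = omegaC D A z :=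
  (omegaAlong_le_omegaC hD hDc hM hAc hA hz).antisymm
    ((omegaC_le_omega hA z).trans (omega_le_omegaAlong hM hA z))

theorem omega_eq_omegaC (hD : IsOpen D) (hDc : IsCompact (closure D)) (hM : IsInward D M)
    (hAc : IsCompact A) (hA : A ⊆ closure D) (hz : z ∈ D) : omega D A z = omegaC D A z :=
  ((omega_le_omegaAlong hM hA z).trans (omegaAlong_le_omegaC hD hDc hM hAc hA hz)).antisymm
    (omegaC_le_omega hA z)

theorem omegaR_eq_omegaAlong_id (D A : Set (Fin n → ℂ)) :
    omegaR D A = omegaAlong D (ContinuousLinearMap.id ℂ _) A := by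
  have hlim (u : (Fin n → ℂ) → EReal) (ζ : Fin n → ℂ) :
      radialLimit u ζ = limsup (fun t : ℝ => u (ζ - (t : ℂ) • ζ)) (𝓝[>] 0) := by
    have hmap : map (fun t : ℝ => 1 - t) (𝓝[>] 0) = 𝓝[<] 1 := by
      simp only [map_subLeft_nhdsGT, sub_zero]
    rw [radialLimit, ← hmap, ← limsup_comp]
    simp only [Function.comp_def, Complex.ofReal_sub, Complex.ofReal_one, sub_smul, one_smul]
  funext z
  simp only [omegaR, omegaAlong, hlim, ContinuousLinearMap.id_apply]

end OmegaAlong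

/-! ### Ellipsoids -/

section Ellipsoid

open Matrix

variable {n : ℕ} {G H : Matrix (Fin n) (Fin n) ℂ}

theorem continuous_hermForm (H : Matrix (Fin n) (Fin n) ℂ) : Continuous (hermForm H) :=
  Complex.continuous_re.comp
    (continuous_star.dotProduct (continuous_const.matrix_mulVec continuous_id))

theorem hermForm_zero (H : Matrix (Fin n) (Fin n) ℂ) : hermForm H 0 = 0 := by
  rw [hermForm, mulVec_zero, dotProduct_zero, Complex.zero_re]

theorem hermForm_smul (H : Matrix (Fin n) (Fin n) ℂ) (t : ℝ) (x : Fin n → ℂ) :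
    hermForm H ((t : ℂ) • x) = t ^ 2 * hermForm H x := by
  simp only [hermForm, star_smul, mulVec_smul, smul_dotProduct, dotProduct_smul, smul_eq_mul,
    Complex.star_def, Complex.conj_ofReal, Complex.re_ofReal_mul]
  ring

theorem hermForm_add_smul (hH : H.IsHermitian) (x y : Fin n → ℂ) (t : ℝ) :
    hermForm H (x + (t : ℂ) • y) =
      hermForm H x + 2 * t * (star y ⬝ᵥ H *ᵥ x).re + t ^ 2 * hermForm H y := by
  have hsymm : (star x ⬝ᵥ H *ᵥ y).re = (star y ⬝ᵥ H *ᵥ x).re := by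
    rw [dotProduct_mulVec, ← hH.eq, ← star_mulVec, star_dotProduct, Complex.star_def,
      Complex.conj_re, hH.eq]
  simp only [hermForm, star_add, star_smul, mulVec_add, mulVec_smul, add_dotProduct,
    dotProduct_add, smul_dotProduct, dotProduct_smul, smul_eq_mul, Complex.add_re,
    Complex.star_def, Complex.conj_ofReal, Complex.re_ofReal_mul, hsymm]
  ring

theorem hermForm_sub_smul_mulVec (hH : H.IsHermitian) (x : Fin n → ℂ) (t : ℝ) :
    hermForm H (x - (t : ℂ) • H *ᵥ x) =
      hermForm H x - 2 * t * hermForm 1 (H *ᵥ x) + t ^ 2 * hermForm H (H *ᵥ x) := by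
  have h := hermForm_add_smul hH x (H *ᵥ x) (-t)
  rw [Complex.ofReal_neg, neg_smul, ← sub_eq_add_neg] at h
  rw [h, hermForm, hermForm, hermForm, one_mulVec]
  ring

theorem exists_hermForm_le_mul (hG : G.PosDef) (H : Matrix (Fin n) (Fin n) ℂ) :
    ∃ C, 0 ≤ C ∧ ∀ x, hermForm H x ≤ C * hermForm G x := by
  have hGpos : ∀ x ∈ Metric.sphere (0 : Fin n → ℂ) 1, 0 < hermForm G x := fun x hx =>
    hG.re_dotProduct_pos (Metric.ne_of_mem_sphere hx one_ne_zero)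
  obtain ⟨C, hC, hle⟩ := exists_forall_le_add_mul (isCompact_sphere (0 : Fin n → ℂ) 1)
    (continuous_hermForm H).continuousOn.upperSemicontinuousOn
    (continuous_hermForm G).continuousOn (fun x hx => (hGpos x hx).le)
    (fun x hx h => ((hGpos x hx).ne' h).elim) (a := 0)
  refine ⟨C, hC, fun x => ?_⟩
  obtain rfl | hx := eq_or_ne x 0
  · rw [hermForm_zero, hermForm_zero, mul_zero]
  have hmem : ((‖x‖⁻¹ : ℝ) : ℂ) • x ∈ Metric.sphere (0 : Fin n → ℂ) 1 := by
    rw [mem_sphere_zero_iff_norm, norm_smul, Complex.norm_real, norm_inv, norm_norm,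
      inv_mul_cancel₀ (norm_ne_zero_iff.2 hx)]
  have h := hle _ hmem
  rw [hermForm_smul, hermForm_smul, zero_add, mul_left_comm] at h
  exact le_of_mul_le_mul_left h (by positivity)

theorem isOpen_ellipsoid (H : Matrix (Fin n) (Fin n) ℂ) : IsOpen (ellipsoid H) :=
  isOpen_lt (continuous_hermForm H) continuous_const

theorem hermForm_le_one_of_mem_closure {x : Fin n → ℂ} (hx : x ∈ closure (ellipsoid H)) :
    hermForm H x ≤ 1 :=
  closure_lt_subset_le (continuous_hermForm H) continuous_const hx

theorem norm_sq_le_hermForm_one (x : Fin n → ℂ) : ‖x‖ ^ 2 ≤ hermForm 1 x := by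
  have hsum : hermForm 1 x = ∑ i, ‖x i‖ ^ 2 := by
    simp only [hermForm, one_mulVec, dotProduct, Pi.star_apply, Complex.star_def, Complex.re_sum,
      Complex.conj_mul', ← Complex.ofReal_pow, Complex.ofReal_re]
  have hsum0 : 0 ≤ ∑ i, ‖x i‖ ^ 2 := by positivity
  rw [hsum, ← Real.le_sqrt (norm_nonneg x) hsum0, pi_norm_le_iff_of_nonneg (Real.sqrt_nonneg _)]
  exact fun i => Real.le_sqrt_of_sq_le
    (Finset.single_le_sum (fun j _ => sq_nonneg ‖x j‖) (Finset.mem_univ i))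

theorem isCompact_closure_ellipsoid (hH : H.PosDef) : IsCompact (closure (ellipsoid H)) := by
  obtain ⟨C, hC, hle⟩ := exists_hermForm_le_mul hH 1
  refine (isCompact_closedBall (0 : Fin n → ℂ) √C).of_isClosed_subset isClosed_closure
    fun x hx => ?_
  refine mem_closedBall_zero_iff.2 (Real.le_sqrt_of_sq_le ?_)
  calc ‖x‖ ^ 2 ≤ hermForm 1 x := norm_sq_le_hermForm_one x
    _ ≤ C * hermForm H x := hle x
    _ ≤ C := mul_le_of_le_one_right hC (hermForm_le_one_of_mem_closure hx)

theorem isInward_ellipsoid_id (H : Matrix (Fin n) (Fin n) ℂ) :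
    IsInward (ellipsoid H) (ContinuousLinearMap.id ℂ _) := by
  filter_upwards [Ioo_mem_nhdsGT (zero_lt_one' ℝ)] with t ⟨ht0, ht1⟩ x hx
  have hsub : x - (t : ℂ) • x = ((1 - t : ℝ) : ℂ) • x := by
    rw [Complex.ofReal_sub, Complex.ofReal_one, sub_smul, one_smul]
  rw [ContinuousLinearMap.id_apply, hsub]
  calc hermForm H (((1 - t : ℝ) : ℂ) • x) = (1 - t) ^ 2 * hermForm H x := hermForm_smul H _ x
    _ ≤ (1 - t) ^ 2 := mul_le_of_le_one_right (sq_nonneg _) (hermForm_le_one_of_mem_closure hx)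
    _ < 1 := by nlinarith

theorem isInward_ellipsoid_mulVec (hH : H.IsHermitian) :
    IsInward (ellipsoid H) (LinearMap.toContinuousLinearMap H.mulVecLin) := by
  obtain ⟨C, hC, hle⟩ := exists_hermForm_le_mul PosDef.one H
  filter_upwards [Ioo_mem_nhdsGT (show (0 : ℝ) < 1 / (C + 1) by positivity)] with t ⟨ht0, htC⟩ x hx
  rw [LinearMap.coe_toContinuousLinearMap', mulVecLin_apply]
  obtain hy | hy := eq_or_ne (H *ᵥ x) 0
  · change hermForm H _ < 1
    rw [hy, smul_zero, sub_zero, hermForm, hy, dotProduct_zero, Complex.zero_re]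
    exact zero_lt_one
  have hpos : 0 < hermForm 1 (H *ᵥ x) :=
    (pow_pos (norm_pos_iff.2 hy) 2).trans_le (norm_sq_le_hermForm_one _)
  have htC' : t * C ≤ 1 := by
    have := (lt_div_iff₀ (by positivity)).1 htC
    linarith
  have hquad : t ^ 2 * hermForm H (H *ᵥ x) ≤ t * hermForm 1 (H *ᵥ x) :=
    calc t ^ 2 * hermForm H (H *ᵥ x) ≤ t ^ 2 * (C * hermForm 1 (H *ᵥ x)) := by
          gcongr; exact hle _
      _ = t * C * (t * hermForm 1 (H *ᵥ x)) := by ring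
      _ ≤ t * hermForm 1 (H *ᵥ x) := mul_le_of_le_one_left (by positivity) htC'
  calc hermForm H (x - (t : ℂ) • H *ᵥ x)
      = hermForm H x - 2 * t * hermForm 1 (H *ᵥ x) + t ^ 2 * hermForm H (H *ᵥ x) :=
        hermForm_sub_smul_mulVec hH x t
    _ ≤ 1 - t * hermForm 1 (H *ᵥ x) := by linarith [hermForm_le_one_of_mem_closure hx]
    _ < 1 := sub_lt_self 1 (by positivity)

theorem differentiable_hermForm (H : Matrix (Fin n) (Fin n) ℂ) :
    Differentiable ℝ (hermForm H) := by
  have hsum : hermForm H =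
      fun z => Complex.reCLM (∑ i, Complex.conjCLE (z i) * ∑ j, H i j * z j) := rfl
  rw [hsum]
  fun_prop

theorem fderiv_hermForm (hH : H.IsHermitian) (x y : Fin n → ℂ) :
    fderiv ℝ (hermForm H) x y = 2 * (star y ⬝ᵥ H *ᵥ x).re := by
  have hline : (fun t : ℝ => hermForm H (x + t • y)) = fun t : ℝ =>
      hermForm H x + 2 * t * (star y ⬝ᵥ H *ᵥ x).re + t ^ 2 * hermForm H y := by
    funext t
    rw [← hermForm_add_smul hH, Complex.coe_smul]
  have hderiv : HasDerivAt (fun t : ℝ => hermForm H x + 2 * t * (star y ⬝ᵥ H *ᵥ x).re +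
      t ^ 2 * hermForm H y) (2 * 1 * (star y ⬝ᵥ H *ᵥ x).re +
        ((2 : ℕ) * (0 : ℝ) ^ (2 - 1)) * hermForm H y) 0 :=
    ((((hasDerivAt_id (0 : ℝ)).const_mul 2).mul_const _).const_add _).add
      ((hasDerivAt_pow 2 (0 : ℝ)).mul_const _)
  rw [← (differentiable_hermForm H x).lineDeriv_eq_fderiv, lineDeriv, hline, hderiv.deriv]
  ring

theorem dbarGrad_hermForm_sub_const (hH : H.IsHermitian) (c : ℝ) (x : Fin n → ℂ) :
    dbarGrad (fun w => hermForm H w - c) x = H *ᵥ x := by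
  ext j
  have hsingle (a : ℂ) : star (Pi.single j a : Fin n → ℂ) ⬝ᵥ H *ᵥ x = star a * (H *ᵥ x) j := by
    rw [← Pi.single_star, single_dotProduct]
  rw [dbarGrad, fderiv_sub_const, fderiv_hermForm hH, fderiv_hermForm hH, hsingle, hsingle]
  apply Complex.ext <;> simp

theorem omegaN_eq_omegaAlong_mulVec (hH : H.IsHermitian) (D A : Set (Fin n → ℂ)) (c : ℝ) :
    omegaN D (fun w => hermForm H w - c) A =
      omegaAlong D (LinearMap.toContinuousLinearMap H.mulVecLin) A := by
  funext z
  simp only [omegaN, omegaAlong, normalLimit, normalPoint, dbarGrad_hermForm_sub_const hH,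
    LinearMap.coe_toContinuousLinearMap', mulVecLin_apply]

end Ellipsoid

end BoundaryExtremal

open BoundaryExtremal in
theorem mainTheorem1_general {n : ℕ} {H : Matrix (Fin n) (Fin n) ℂ} {A : Set (Fin n → ℂ)}
    {z : Fin n → ℂ} (hH : H.PosDef) (hA : IsCompact A) (hAD : A ⊆ closure (ellipsoid H))
    (hz : z ∈ ellipsoid H) :
    omega (ellipsoid H) A z = omegaN (ellipsoid H) (fun w => hermForm H w - 1) A z ∧
      omegaN (ellipsoid H) (fun w => hermForm H w - 1) A z = omegaR (ellipsoid H) A z ∧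
      omegaR (ellipsoid H) A z = omegaC (ellipsoid H) A z := by
  have hD := isOpen_ellipsoid H
  have hDc := isCompact_closure_ellipsoid hH
  have hid := isInward_ellipsoid_id H
  have hmulVec := isInward_ellipsoid_mulVec hH.isHermitian
  rw [omegaN_eq_omegaAlong_mulVec hH.isHermitian, omegaR_eq_omegaAlong_id,
    omegaAlong_eq_omegaC hD hDc hmulVec hA hAD hz, omegaAlong_eq_omegaC hD hDc hid hA hAD hz,
    omega_eq_omegaC hD hDc hid hA hAD hz]
  exact ⟨rfl, rfl, rfl⟩

theorem mainTheorem1 (n : ℕ) (H : Matrix (Fin n) (Fin n) ℂ) (hH : H.PosDef)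
    (A : Set (Fin n → ℂ)) (hA : IsCompact A)
    (hAD : A ⊆ frontier (BoundaryExtremal.ellipsoid H))
    (z : Fin n → ℂ) (hz : z ∈ BoundaryExtremal.ellipsoid H) :
    BoundaryExtremal.omega (BoundaryExtremal.ellipsoid H) A z =
        BoundaryExtremal.omegaN (BoundaryExtremal.ellipsoid H)
          (fun w => BoundaryExtremal.hermForm H w - 1) A z ∧
      BoundaryExtremal.omegaN (BoundaryExtremal.ellipsoid H)
          (fun w => BoundaryExtremal.hermForm H w - 1) A z =
        BoundaryExtremal.omegaR (BoundaryExtremal.ellipsoid H) A z ∧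
      BoundaryExtremal.omegaR (BoundaryExtremal.ellipsoid H) A z =
        BoundaryExtremal.omegaC (BoundaryExtremal.ellipsoid H) A z :=
  mainTheorem1_general hH hA (hAD.trans frontier_subset_closure) hz
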